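/- Let $\Lambda\subset\mathbb{C}^2$ be a lattice, i.e. a discrete additive subgroup (of any rank). For $p\in\mathbb{C}^2$ and $r>0$ let $\Delta^2(p;r)=\{z\in\mathbb{C}^2: |z_1-p_1|<r,\ |z_2-p_2|<r\}$ be the open bidisk with centre $p$ and radius $r$ in both coordinates. (a) Let $p_1,\dots,p_m\in\mathbb{C}^2$, let $\Lambda_0=\bigcup_{j=1}^m(\Lambda+p_j)$, and for $r>0$ let $\Lambda_{0,r}=\bigcup_{p\in\Lambda_0}\Delta^2(p;r)$. Then for some $r>0$ there exists an injective holomorphic map $F:\mathbb{C}^2\to\mathbb{C}^2\setminus\Lambda_{0,r}$. (b) Suppose moreover that $\Lambda$ spans $\mathbb{C}^2$ over $\mathbb{R}$ (i.e. has rank 4), let $T=\mathbb{C}^2/\Lambda$ be the corresponding complex 2-torus, and let $E\subset T$ be finite. Then there exist an open set $U\subset T$ containing $E$ and a dominating map from $\mathbb{C}^2$ into $T\setminus U$, that is, a holomorphic map $F:\mathbb{C}^2\to T$ with $F(\mathbb{C}^2)\cap U=\emptyset$ whose Jacobian determinant is not identically zero. -/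

import Mathlib

open Topology

/-- The open bidisk `Δ²(p; r)` in `ℂ²` with centre `p` and radius `r` in both coordinates. -/
def bidisk (p : ℂ × ℂ) (r : ℝ) : Set (ℂ × ℂ) :=
  {z | ‖z.1 - p.1‖ < r ∧ ‖z.2 - p.2‖ < r}

/-- `Λ₀`, the union of the translates `Λ + p₁, …, Λ + p_m`. -/
def translates (Λ : Submodule ℤ (ℂ × ℂ)) {m : ℕ} (p : Fin m → ℂ × ℂ) : Set (ℂ × ℂ) :=
  ⋃ j, (fun v => v + p j) '' (Λ : Set (ℂ × ℂ))

/-- `Λ_{0,r}`, the union of the bidisks of radius `r` centred at the points of `Λ₀`. -/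
def bidiskUnion (Λ : Submodule ℤ (ℂ × ℂ)) {m : ℕ} (p : Fin m → ℂ × ℂ) (r : ℝ) : Set (ℂ × ℂ) :=
  ⋃ q ∈ translates Λ p, bidisk q r

/-- Near `z`, the map `G` is a holomorphic lift of `F : ℂ² → ℂ²/Λ` to `ℂ²`. -/
def IsHolomorphicLiftAt (Λ : Submodule ℤ (ℂ × ℂ)) (F : ℂ × ℂ → (ℂ × ℂ) ⧸ Λ)
    (G : ℂ × ℂ → ℂ × ℂ) (z : ℂ × ℂ) : Prop :=
  ∀ᶠ w in 𝓝 z, DifferentiableAt ℂ G w ∧ Λ.mkQ (G w) = F w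

/-- Holomorphic maps `ℂ² → ℂ²/Λ`. The complex structure of `ℂ²/Λ` (`Λ` discrete) is the one whose
charts are the local inverses of the projection, so holomorphy means having holomorphic lifts
locally. -/
def IsHolomorphicToTorus (Λ : Submodule ℤ (ℂ × ℂ)) (F : ℂ × ℂ → (ℂ × ℂ) ⧸ Λ) : Prop :=
  ∀ z, ∃ G, IsHolomorphicLiftAt Λ F G z

/-- Dominating maps `ℂ² → ℂ²/Λ`: holomorphic maps whose Jacobian determinant (computed in the
charts above, that is, on local lifts) is not identically zero. -/
def IsDominatingToTorus (Λ : Submodule ℤ (ℂ × ℂ)) (F : ℂ × ℂ → (ℂ × ℂ) ⧸ Λ) : Prop :=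
  IsHolomorphicToTorus Λ F ∧
    ∃ z G, IsHolomorphicLiftAt Λ F G z ∧ (fderiv ℂ G z).det ≠ 0

/-! The lattice problem is reduced to avoiding one fixed set. Linearizing `henon` at its repelling
fixed point gives an injective entire map whose image misses the cone-like set V where `|z| ≥
max(12, |w|)` (`exists_injective_entire_avoiding`).

It then suffices to push the small bidisks into V by an automorphism of `ℂ²`. In suitable complex
linear coordinates both imaginary parts are integers on `Λ` (`exists_equiv_im_int`). Multiplying by
a positive integer `q` keeps this true and, by Diophantine approximation
(`exists_nat_mul_near_int`), brings the finitely many translates close to integral as well. For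
small `r` all bidisks then lie where both imaginary parts are nearly integers.

Two shears carry that region into V (`exists_shears`). The second adds `i G(w)` to `z`, with `Re G`
large near the lines `Im w ∈ ℤ`. If `Re G` were positive on all of them, this could cancel against a
very negative `Im z`; so the first shear adds to `w` an entire function of `z` close to `0` above
and to `i/2` below (`exists_entire_near_zero_near_half`), and `Re G` changes sign under the
half-shift. Pulling the Fatou–Bieberbach map back through these automorphisms proves (a), and
composing with the projection to the torus proves (b). -/

/-! ### A Fatou–Bieberbach map from a Hénon map -/

/-- The Hénon map `(z, w) ↦ (2w, 2z + w²)`; the origin is a repelling fixed point. -/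
def henon (p : ℂ × ℂ) : ℂ × ℂ := (2 * p.2, 2 * p.1 + p.2 ^ 2)

/-- The inverse of the linear part of `henon`. -/
noncomputable def halfSwap (p : ℂ × ℂ) : ℂ × ℂ := (p.2 / 2, p.1 / 2)

/-- The `n`-th approximation `henonⁿ ∘ halfSwapⁿ` of the linearizing map of `henon`. -/
noncomputable def henonApprox : ℕ → ℂ × ℂ → ℂ × ℂ
  | 0 => id
  | n + 1 => fun p => henon (henonApprox n (halfSwap p))

theorem norm_halfSwap (p : ℂ × ℂ) : ‖halfSwap p‖ = ‖p‖ / 2 := by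
  simp only [halfSwap, Prod.norm_def, norm_div, Complex.norm_ofNat]
  rw [max_comm, max_div_div_right (by norm_num)]

theorem halfSwap_sub (p q : ℂ × ℂ) : halfSwap p - halfSwap q = halfSwap (p - q) := by
  simp [halfSwap, sub_div]

theorem henon_sub_norm_le (u v : ℂ × ℂ) :
    ‖henon u - henon v‖ ≤ (2 + (‖u‖ + ‖v‖)) * ‖u - v‖ := by
  have h1 : ‖u.1 - v.1‖ ≤ ‖u - v‖ := norm_fst_le (u - v)
  have h2 : ‖u.2 - v.2‖ ≤ ‖u - v‖ := norm_snd_le (u - v)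
  have hu := norm_snd_le u
  have hv := norm_snd_le v
  have h0 := norm_nonneg (u - v)
  rw [Prod.norm_def]
  refine max_le ?_ ?_
  · have : (henon u - henon v).1 = 2 * (u.2 - v.2) := by simp [henon]; ring
    rw [this, norm_mul, Complex.norm_ofNat]
    nlinarith [norm_nonneg u, norm_nonneg v]
  · have : (henon u - henon v).2 = 2 * (u.1 - v.1) + (u.2 + v.2) * (u.2 - v.2) := by
      simp [henon]; ring
    rw [this]
    refine (norm_add_le _ _).trans ?_
    rw [norm_mul, norm_mul, Complex.norm_ofNat]
    have := norm_add_le u.2 v.2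
    have : ‖u.2 + v.2‖ * ‖u.2 - v.2‖ ≤ (‖u‖ + ‖v‖) * ‖u - v‖ := by gcongr; linarith
    linarith

theorem henon_sub_sub_norm_le (u v p q : ℂ × ℂ) :
    ‖(henon u - p) - (henon v - q)‖ ≤
      2 * ‖(u - halfSwap p) - (v - halfSwap q)‖ + (‖u‖ + ‖v‖) * ‖u - v‖ := by
  set d := (u - halfSwap p) - (v - halfSwap q) with hd
  have h1 : ‖d.1‖ ≤ ‖d‖ := norm_fst_le d
  have h2 : ‖d.2‖ ≤ ‖d‖ := norm_snd_le d
  have h3 : ‖u.2 - v.2‖ ≤ ‖u - v‖ := norm_snd_le (u - v)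
  have hu := norm_snd_le u
  have hv := norm_snd_le v
  have h0 := norm_nonneg (u - v)
  rw [Prod.norm_def]
  refine max_le ?_ ?_
  · have : ((henon u - p) - (henon v - q)).1 = 2 * d.2 := by simp [henon, hd, halfSwap]; ring
    rw [this, norm_mul, Complex.norm_ofNat]
    have : 0 ≤ (‖u‖ + ‖v‖) * ‖u - v‖ := by positivity
    linarith
  · have : ((henon u - p) - (henon v - q)).2 = 2 * d.1 + (u.2 + v.2) * (u.2 - v.2) := by
      simp [henon, hd, halfSwap]; ring
    rw [this]
    refine (norm_add_le _ _).trans ?_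
    rw [norm_mul, norm_mul, Complex.norm_ofNat]
    have := norm_add_le u.2 v.2
    have : ‖u.2 + v.2‖ * ‖u.2 - v.2‖ ≤ (‖u‖ + ‖v‖) * ‖u - v‖ := by gcongr; linarith
    linarith

theorem henonApprox_zero (n : ℕ) : henonApprox n 0 = 0 := by
  induction n with
  | zero => rfl
  | succ n ih =>
    have : halfSwap 0 = 0 := by simp [halfSwap]
    simp [henonApprox, this, ih, henon]

/-- A Lipschitz bound for the deviation from the identity, uniform in `n`. The radius `s` is left
free because each step halves it: the inherited error contributes at most `s ‖p - q‖` and the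
quadratic term of `henon` at most `25/32 * s ‖p - q‖`, so the constant `2 * s` reproduces itself. -/
theorem henonApprox_sub_sub_norm_le (n : ℕ) : ∀ (s : ℝ) (p q : ℂ × ℂ), s ≤ 1 / 4 → ‖p‖ ≤ s →
    ‖q‖ ≤ s → ‖(henonApprox n p - p) - (henonApprox n q - q)‖ ≤ 2 * s * ‖p - q‖ := by
  induction n with
  | zero =>
    intro s p q _ hp _
    have : 0 ≤ s := (norm_nonneg p).trans hp
    simp only [henonApprox, id, sub_self, norm_zero]
    positivity
  | succ n ih =>
    intro s p q hs hp hq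
    have hs0 : 0 ≤ s := (norm_nonneg p).trans hp
    have hp' : ‖halfSwap p‖ ≤ s / 2 := by rw [norm_halfSwap]; linarith
    have hq' : ‖halfSwap q‖ ≤ s / 2 := by rw [norm_halfSwap]; linarith
    have h0' : ‖(0 : ℂ × ℂ)‖ ≤ s / 2 := by rw [norm_zero]; linarith
    have hpq : ‖halfSwap p - halfSwap q‖ = ‖p - q‖ / 2 := by rw [halfSwap_sub, norm_halfSwap]
    have h1 := ih (s / 2) _ _ (by linarith) hp' hq'
    have h2 := ih (s / 2) _ _ (by linarith) hp' h0'
    have h3 := ih (s / 2) _ _ (by linarith) hq' h0'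
    simp only [henonApprox_zero, sub_zero] at h2 h3
    rw [hpq] at h1
    set u := henonApprox n (halfSwap p) with hu
    set v := henonApprox n (halfSwap q) with hv
    set d := ‖p - q‖ with hd
    have hd0 : 0 ≤ d := norm_nonneg _
    have hun : ‖u‖ ≤ 5 / 8 * s := by
      have := norm_add_le (u - halfSwap p) (halfSwap p)
      rw [sub_add_cancel] at this
      nlinarith [norm_nonneg (halfSwap p)]
    have hvn : ‖v‖ ≤ 5 / 8 * s := by
      have := norm_add_le (v - halfSwap q) (halfSwap q)
      rw [sub_add_cancel] at this
      nlinarith [norm_nonneg (halfSwap q)]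
    have huv : ‖u - v‖ ≤ 5 / 8 * d := by
      have := norm_add_le ((u - halfSwap p) - (v - halfSwap q)) (halfSwap p - halfSwap q)
      rw [hpq, show (u - halfSwap p) - (v - halfSwap q) + (halfSwap p - halfSwap q) = u - v by abel]
        at this
      nlinarith
    refine (henon_sub_sub_norm_le u v p q).trans ?_
    have : (‖u‖ + ‖v‖) * ‖u - v‖ ≤ (5 / 8 * s + 5 / 8 * s) * (5 / 8 * d) := by gcongr
    nlinarith [mul_nonneg hs0 hd0]

theorem henonApprox_norm_le (n : ℕ) {p : ℂ × ℂ} (hp : ‖p‖ ≤ 1 / 4) :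
    ‖henonApprox n p‖ ≤ 3 / 2 * ‖p‖ := by
  have h := henonApprox_sub_sub_norm_le n (‖p‖) p 0 hp le_rfl (by simp)
  simp only [henonApprox_zero, sub_zero] at h
  have := norm_add_le (henonApprox n p - p) p
  rw [sub_add_cancel] at this
  nlinarith [norm_nonneg p]

/-- Near the origin `henon` expands distances by at most `8/3`, while halving the argument divides a
quadratic error by `4`; hence the ratio `2/3`. -/
theorem henonApprox_succ_sub_norm_le (n : ℕ) : ∀ p : ℂ × ℂ, ‖p‖ ≤ 1 / 4 →
    ‖henonApprox (n + 1) p - henonApprox n p‖ ≤ (2 / 3 : ℝ) ^ n * ‖p‖ ^ 2 := by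
  induction n with
  | zero =>
    intro p _
    have : henonApprox 1 p - henonApprox 0 p = (0, (p.1 / 2) ^ 2) := by
      simp [henonApprox, henon, halfSwap]
      ext <;> simp <;> ring
    rw [this, Prod.norm_def]
    have := norm_fst_le p
    simp only [norm_zero, norm_pow, norm_div, Complex.norm_ofNat, pow_zero, one_mul]
    refine max_le (by positivity) ?_
    nlinarith [norm_nonneg p.1, norm_nonneg p]
  | succ n ih =>
    intro p hp
    have hp' : ‖halfSwap p‖ = ‖p‖ / 2 := norm_halfSwap p
    have hp4 : ‖halfSwap p‖ ≤ 1 / 4 := by rw [hp']; linarith [norm_nonneg p]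
    have h1 := ih _ hp4
    have h2 := henonApprox_norm_le n hp4
    have h3 := henonApprox_norm_le (n + 1) hp4
    refine (henon_sub_norm_le _ _).trans ?_
    rw [hp'] at h1 h2 h3
    have h4 : 2 + (‖henonApprox (n + 1) (halfSwap p)‖ + ‖henonApprox n (halfSwap p)‖) ≤ 8 / 3 := by
      linarith
    calc _ ≤ 8 / 3 * ((2 / 3 : ℝ) ^ n * (‖p‖ / 2) ^ 2) := by gcongr
      _ = _ := by ring

theorem differentiable_henon : Differentiable ℂ henon := by
  unfold henon; fun_prop

theorem differentiable_halfSwap : Differentiable ℂ halfSwap := by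
  unfold halfSwap; fun_prop

theorem differentiable_henonApprox (n : ℕ) : Differentiable ℂ (henonApprox n) := by
  induction n with
  | zero => exact differentiable_id
  | succ n ih => exact differentiable_henon.comp (ih.comp differentiable_halfSwap)

/-- Cauchy's estimate for the Fréchet derivative. -/
theorem norm_fderiv_le_of_forall_ball {E F : Type*} [NormedAddCommGroup E] [NormedSpace ℂ E]
    [NormedAddCommGroup F] [NormedSpace ℂ F] {f : E → F} (hf : Differentiable ℂ f)
    {x : E} {r M : ℝ} (hr : 0 < r) (hM : 0 ≤ M) (h : ∀ y, ‖y - x‖ ≤ r → ‖f y‖ ≤ M) :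
    ‖fderiv ℂ f x‖ ≤ M / r := by
  refine ContinuousLinearMap.opNorm_le_bound _ (by positivity) fun v => ?_
  rcases eq_or_ne v 0 with rfl | hv
  · simp
  have hv' : 0 < ‖v‖ := norm_pos_iff.2 hv
  have hline : Differentiable ℂ fun t : ℂ => x + t • v := by fun_prop
  have hd : HasDerivAt (fun t : ℂ => f (x + t • v)) (fderiv ℂ f x v) 0 := by
    have h1 : HasDerivAt (fun t : ℂ => x + t • v) v 0 := by
      simpa using ((hasDerivAt_id (0 : ℂ)).smul_const v).const_add x
    have h2 : HasFDerivAt f (fderiv ℂ f x) (x + (0 : ℂ) • v) := by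
      simpa using (hf x).hasFDerivAt
    exact h2.comp_hasDerivAt 0 h1
  have := Complex.norm_deriv_le_of_forall_mem_sphere_norm_le (f := fun t : ℂ => f (x + t • v))
    (c := 0) (R := r / ‖v‖) (C := M) (by positivity)
    (hf.comp hline).diffContOnCl (fun t ht => h _ (by
      rw [mem_sphere_zero_iff_norm] at ht
      rw [add_sub_cancel_left, norm_smul, ht]
      field_simp; rfl))
  rw [hd.deriv] at this
  calc _ ≤ M / (r / ‖v‖) := this
    _ = M / r * ‖v‖ := by field_simp

theorem exists_tendsto_henonApprox_of_norm_lt :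
    ∃ F : ℂ × ℂ → ℂ × ℂ, DifferentiableOn ℂ F (Metric.ball 0 (1 / 8)) ∧
      ∀ p, ‖p‖ < 1 / 8 → Filter.Tendsto (fun n => henonApprox n p) Filter.atTop (𝓝 (F p)) := by
  set D : ℕ → ℂ × ℂ → ℂ × ℂ := fun n p => henonApprox (n + 1) p - henonApprox n p with hD
  have hDd : ∀ n, Differentiable ℂ (D n) := fun n =>
    (differentiable_henonApprox (n + 1)).sub (differentiable_henonApprox n)
  have hDn : ∀ n p, ‖p‖ ≤ 1 / 4 → ‖D n p‖ ≤ (2 / 3 : ℝ) ^ n := fun n p hp => by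
    refine (henonApprox_succ_sub_norm_le n p hp).trans ?_
    exact mul_le_of_le_one_right (by positivity) (by nlinarith [norm_nonneg p])
  have hsum : Summable fun n : ℕ => (2 / 3 : ℝ) ^ n :=
    summable_geometric_of_lt_one (by norm_num) (by norm_num)
  have hDf : ∀ n, ∀ p ∈ Metric.ball (0 : ℂ × ℂ) (1 / 8),
      ‖fderiv ℂ (D n) p‖ ≤ (2 / 3 : ℝ) ^ n / (1 / 8) := fun n p hp => by
    rw [mem_ball_zero_iff] at hp
    refine norm_fderiv_le_of_forall_ball (hDd n) (by norm_num) (by positivity) fun y hy => hDn n y ?_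
    have := norm_add_le (y - p) p
    rw [sub_add_cancel] at this
    linarith
  refine ⟨fun p => p + ∑' n, D n p, ?_, fun p hp => ?_⟩
  -- The derivatives of the series are summable by Cauchy's estimate: a ball of radius `1/8` about
  -- `p` stays in the ball of radius `1/4` where the terms are bounded.
  · refine differentiableOn_id.add fun p hp => ?_
    refine (hasFDerivAt_tsum_of_isPreconnected (hsum.div_const (1 / 8)) Metric.isOpen_ball
      (convex_ball _ _).isPreconnected (fun n x _ => (hDd n x).hasFDerivAt) hDf
      (Metric.mem_ball_self (by norm_num)) ?_ hp).differentiableAt.differentiableWithinAt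
    exact Summable.of_norm_bounded hsum fun n => hDn n 0 (by simp)
  · have hs : Summable fun n => D n p :=
      Summable.of_norm_bounded hsum fun n => hDn n p (by linarith)
    have := (hs.hasSum.tendsto_sum_nat).const_add p
    refine this.congr fun n => ?_
    rw [hD, Finset.sum_range_sub (fun n => henonApprox n p)]
    simp [henonApprox]

/-- The functional equation extends both convergence and holomorphy from a ball to the ball of twice
the radius. -/
theorem exists_tendsto_henonApprox :
    ∃ F : ℂ × ℂ → ℂ × ℂ,
      (∀ p, Filter.Tendsto (fun n => henonApprox n p) Filter.atTop (𝓝 (F p))) ∧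
      Differentiable ℂ F ∧ ∀ p, F p = henon (F (halfSwap p)) := by
  obtain ⟨F₀, hF₀, hlim⟩ := exists_tendsto_henonApprox_of_norm_lt
  have hstep : ∀ p q, Filter.Tendsto (fun n => henonApprox n (halfSwap p)) Filter.atTop (𝓝 q) →
      Filter.Tendsto (fun n => henonApprox n p) Filter.atTop (𝓝 (henon q)) := fun p q h => by
    rw [← Filter.tendsto_add_atTop_iff_nat 1]
    exact (differentiable_henon.continuous.tendsto q).comp h
  have hex : ∀ m : ℕ, ∀ p : ℂ × ℂ, ‖p‖ < 1 / 8 * 2 ^ m →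
      ∃ q, Filter.Tendsto (fun n => henonApprox n p) Filter.atTop (𝓝 q) := by
    intro m
    induction m with
    | zero => exact fun p hp => ⟨_, hlim p (by simpa using hp)⟩
    | succ m ih =>
      intro p hp
      obtain ⟨q, hq⟩ := ih (halfSwap p) (by rw [norm_halfSwap]; rw [pow_succ] at hp; linarith)
      exact ⟨_, hstep p q hq⟩
  have hbig : ∀ p : ℂ × ℂ, ∃ m : ℕ, ‖p‖ < 1 / 8 * 2 ^ m := fun p => by
    obtain ⟨m, hm⟩ := pow_unbounded_of_one_lt (8 * ‖p‖) (one_lt_two)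
    exact ⟨m, by linarith⟩
  choose F hF using fun p => (hbig p).elim fun m hm => hex m p hm
  have hfun : ∀ p, F p = henon (F (halfSwap p)) := fun p =>
    tendsto_nhds_unique (hF p) (hstep p _ (hF _))
  refine ⟨F, hF, ?_, hfun⟩
  have hd : ∀ m : ℕ, DifferentiableOn ℂ F (Metric.ball 0 (1 / 8 * 2 ^ m)) := by
    intro m
    induction m with
    | zero =>
      rw [pow_zero, mul_one]
      refine hF₀.congr fun p hp => ?_
      exact tendsto_nhds_unique (hF p) (hlim p (by simpa using hp))
    | succ m ih =>
      have : DifferentiableOn ℂ (fun p => henon (F (halfSwap p)))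
          (Metric.ball 0 (1 / 8 * 2 ^ (m + 1))) := by
        refine differentiable_henon.comp_differentiableOn
          (ih.comp differentiable_halfSwap.differentiableOn fun p hp => ?_)
        rw [mem_ball_zero_iff] at hp ⊢
        rw [norm_halfSwap]; rw [pow_succ] at hp; linarith
      exact this.congr fun p _ => hfun p
  intro p
  obtain ⟨m, hm⟩ := hbig p
  exact (hd m).differentiableAt (Metric.isOpen_ball.mem_nhds (by simpa using hm))

/-- A Fatou–Bieberbach map, tangent to the identity at the origin, whose image avoids the set
`{|z| ≥ max(12, |w|)}`. -/
theorem exists_injective_entire_avoiding :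
    ∃ F : ℂ × ℂ → ℂ × ℂ, Differentiable ℂ F ∧ Function.Injective F ∧
      fderiv ℂ F 0 = ContinuousLinearMap.id ℂ (ℂ × ℂ) ∧
      ∀ p, ¬ (12 ≤ ‖(F p).1‖ ∧ ‖(F p).2‖ ≤ ‖(F p).1‖) := by
  obtain ⟨F, hlim, hd, hfun⟩ := exists_tendsto_henonApprox
  have hlip : ∀ (s : ℝ) (p q : ℂ × ℂ), s ≤ 1 / 4 → ‖p‖ ≤ s → ‖q‖ ≤ s →
      ‖(F p - p) - (F q - q)‖ ≤ 2 * s * ‖p - q‖ := fun s p q hs hp hq =>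
    le_of_tendsto ((((hlim p).sub_const p).sub ((hlim q).sub_const q)).norm)
      (Filter.Eventually.of_forall fun n => henonApprox_sub_sub_norm_le n s p q hs hp hq)
  have hF0 : F 0 = 0 := tendsto_nhds_unique (hlim 0) (by simp [henonApprox_zero])
  have hquad : ∀ p, ‖p‖ ≤ 1 / 4 → ‖F p - p‖ ≤ 2 * ‖p‖ * ‖p‖ := fun p hp => by
    simpa [hF0] using hlip ‖p‖ p 0 hp le_rfl (by simp)
  have hbig : ∀ p : ℂ × ℂ, ∃ m : ℕ, ‖p‖ ≤ 1 / 4 * 2 ^ m := fun p => by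
    obtain ⟨m, hm⟩ := pow_unbounded_of_one_lt (4 * ‖p‖) (one_lt_two)
    exact ⟨m, by linarith⟩
  refine ⟨F, hd, ?_, ?_, ?_⟩
  -- On the ball of radius `1/4`, `F - id` is Lipschitz with constant `1/2`, so `F` is injective
  -- there; injectivity of `henon` and `halfSwap` carries this to all larger balls.
  · have hinj : ∀ m : ℕ, ∀ p q : ℂ × ℂ, ‖p‖ ≤ 1 / 4 * 2 ^ m → ‖q‖ ≤ 1 / 4 * 2 ^ m →
        F p = F q → p = q := by
      intro m
      induction m with
      | zero =>
        intro p q hp hq h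
        have := hlip (1 / 4) p q le_rfl (by simpa using hp) (by simpa using hq)
        rw [h, sub_sub_sub_cancel_left, norm_sub_rev] at this
        rw [← sub_eq_zero, ← norm_le_zero_iff]
        linarith
      | succ m ih =>
        intro p q hp hq h
        rw [pow_succ] at hp hq
        rw [hfun p, hfun q] at h
        simp only [henon, Prod.mk.injEq, mul_eq_mul_left_iff, OfNat.ofNat_ne_zero, or_false] at h
        have h1 : F (halfSwap p) = F (halfSwap q) := by
          refine Prod.ext ?_ h.1
          have := h.2
          rw [h.1] at this
          linear_combination this / 2
        have := ih _ _ (by rw [norm_halfSwap]; linarith) (by rw [norm_halfSwap]; linarith) h1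
        simp only [halfSwap, Prod.mk.injEq] at this
        exact Prod.ext (by linear_combination 2 * this.2) (by linear_combination 2 * this.1)
    intro p q h
    obtain ⟨m, hm⟩ := hbig p
    obtain ⟨k, hk⟩ := hbig q
    refine hinj (max m k) p q (hm.trans ?_) (hk.trans ?_) h
    · gcongr
      · norm_num
      · exact le_max_left _ _
    · gcongr
      · norm_num
      · exact le_max_right _ _
  · refine HasFDerivAt.fderiv ?_
    rw [hasFDerivAt_iff_isLittleO_nhds_zero]
    refine Asymptotics.IsBigO.trans_isLittleO (g := fun h : ℂ × ℂ => ‖h‖ ^ 2) ?_ ?_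
    · refine Asymptotics.IsBigO.of_bound 2 ?_
      filter_upwards [Metric.ball_mem_nhds (0 : ℂ × ℂ) (by norm_num : (0 : ℝ) < 1 / 4)] with h hh
      rw [mem_ball_zero_iff] at hh
      simpa [hF0, pow_two, mul_assoc] using hquad h hh.le
    · simpa using Asymptotics.isLittleO_norm_pow_id one_lt_two
  -- The avoided set is backward invariant: if `henon q` lies in it, then `‖q.2‖ ≥ 6` and `‖q.2‖² ≤
  -- 2‖q.1‖ + 2‖q.2‖`, whence `‖q.1‖ ≥ 2‖q.2‖ ≥ 12`. Pulling back by `halfSwap` reaches the small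
  -- ball, where `F` is too small to be in the set.
  · have hav : ∀ m : ℕ, ∀ p : ℂ × ℂ, ‖p‖ ≤ 1 / 4 * 2 ^ m →
        ¬ (12 ≤ ‖(F p).1‖ ∧ ‖(F p).2‖ ≤ ‖(F p).1‖) := by
      intro m
      induction m with
      | zero =>
        rintro p hp ⟨h, -⟩
        rw [pow_zero, mul_one] at hp
        have h1 := hquad p hp
        have h2 := norm_add_le (F p - p) p
        rw [sub_add_cancel] at h2
        have h3 := norm_fst_le (F p)
        nlinarith [norm_nonneg p]
      | succ m ih =>
        rintro p hp ⟨h, h'⟩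
        rw [pow_succ] at hp
        refine ih (halfSwap p) (by rw [norm_halfSwap]; linarith) ?_
        rw [hfun p] at h h'
        set q := F (halfSwap p)
        simp only [henon, norm_mul, Complex.norm_ofNat] at h h'
        have h1 : ‖q.2 ^ 2‖ ≤ ‖2 * q.1 + q.2 ^ 2‖ + ‖2 * q.1‖ := by
          have := norm_sub_le (2 * q.1 + q.2 ^ 2) (2 * q.1)
          rwa [add_sub_cancel_left] at this
        rw [norm_pow, norm_mul, Complex.norm_ofNat] at h1
        constructor <;> nlinarith
    intro p
    obtain ⟨m, hm⟩ := hbig p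
    exact hav m p hm

/-! ### An entire function with different limits in the two half-planes -/

open Complex in
/-- The integrand `exp (z t) t⁻ᵗ` of Newman's function in the logarithmic coordinate `s = log t`. -/
noncomputable def newmanKernel (z s : ℂ) : ℂ := exp ((z - s) * exp s)

/-- An entire function that is asymptotically constant in the upper and in the lower half-plane. -/
noncomputable def halfPlaneStep (z : ℂ) : ℂ := ∫ s : ℝ, (newmanKernel z s - newmanKernel (-z) s)

theorem integrable_exp_neg_abs : MeasureTheory.Integrable fun s : ℝ => Real.exp (-|s|) := by
  refine (integrable_inv_one_add_sq.const_mul 2).mono' (by fun_prop)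
    (Filter.Eventually.of_forall fun s => ?_)
  rw [Real.norm_eq_abs, Real.abs_exp, Real.exp_neg, ← div_eq_mul_inv, inv_le_comm₀ (Real.exp_pos _) (by positivity),
    inv_div]
  have := Real.quadratic_le_exp_of_nonneg (abs_nonneg s)
  rw [sq_abs] at this
  linarith [abs_nonneg s]

theorem neg_mul_exp_le_one (s : ℝ) : -s * Real.exp s ≤ 1 := by
  have h := Real.add_one_le_exp (-s)
  have h2 : Real.exp (-s) * Real.exp s = 1 := by rw [← Real.exp_add]; simp
  nlinarith [Real.exp_pos s]

theorem add_sub_mul_exp_le {R : ℝ} (hR : 0 ≤ R) (s : ℝ) :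
    s + (R - s) * Real.exp s ≤ 1 + 4 * R + R * Real.exp R + (R + 1) ^ 2 - |s| := by
  have hRe : 0 ≤ R * Real.exp R := mul_nonneg hR (Real.exp_pos R).le
  rcases le_total s 0 with hs | hs
  · rw [abs_of_nonpos hs]
    have h1 := neg_mul_exp_le_one s
    have h2 : Real.exp s ≤ 1 := Real.exp_le_one_iff.2 hs
    nlinarith
  · rw [abs_of_nonneg hs]
    rcases le_total s R with hsR | hsR
    · have h1 : Real.exp s ≤ Real.exp R := Real.exp_le_exp.2 hsR
      have : (R - s) * Real.exp s ≤ R * Real.exp R :=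
        mul_le_mul (by linarith) h1 (Real.exp_pos s).le hR
      nlinarith
    · have h1 := Real.add_one_le_exp s
      have : (R - s) * Real.exp s ≤ (R - s) * (s + 1) :=
        mul_le_mul_of_nonpos_left h1 (by linarith)
      nlinarith [sq_nonneg (s - (R + 1) / 2)]

theorem norm_newmanKernel (z : ℂ) (s : ℝ) :
    ‖newmanKernel z s‖ = Real.exp ((z.re - s) * Real.exp s) := by
  rw [newmanKernel, Complex.norm_exp]
  congr 1
  rw [← Complex.ofReal_exp, Complex.re_mul_ofReal]
  simp

theorem continuous_newmanKernel (z : ℂ) : Continuous (newmanKernel z) := by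
  unfold newmanKernel; fun_prop

theorem hasDerivAt_newmanKernel_sub (z s : ℂ) :
    HasDerivAt (fun z => newmanKernel z s - newmanKernel (-z) s)
      (Complex.exp s * newmanKernel z s + Complex.exp s * newmanKernel (-z) s) z := by
  unfold newmanKernel
  have h1 : HasDerivAt (fun z : ℂ => (z - s) * Complex.exp s) (Complex.exp s) z := by
    simpa using ((hasDerivAt_id z).sub_const s).mul_const (Complex.exp s)
  have h2 : HasDerivAt (fun z : ℂ => (-z - s) * Complex.exp s) (-Complex.exp s) z := by
    simpa using ((hasDerivAt_id z).neg.sub_const s).mul_const (Complex.exp s)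
  refine (h1.cexp.sub h2.cexp).congr_deriv ?_
  ring

theorem norm_exp_mul_newmanKernel_le {R : ℝ} (z : ℂ) (hz : ‖z‖ ≤ R) (s : ℝ) :
    ‖Complex.exp s * newmanKernel z s‖ ≤
      Real.exp (1 + 4 * R + R * Real.exp R + (R + 1) ^ 2) * Real.exp (-|s|) := by
  have hR : 0 ≤ R := (norm_nonneg z).trans hz
  rw [norm_mul, norm_newmanKernel, Complex.norm_exp, Complex.ofReal_re, ← Real.exp_add,
    ← Real.exp_add, Real.exp_le_exp]
  have h1 : (z.re - s) * Real.exp s ≤ (R - s) * Real.exp s := by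
    gcongr
    exact (Complex.re_le_norm z).trans hz
  linarith [add_sub_mul_exp_le hR s]

theorem norm_deriv_newmanKernel_sub_le {R : ℝ} (z : ℂ) (hz : ‖z‖ ≤ R) (s : ℝ) :
    ‖Complex.exp s * newmanKernel z s + Complex.exp s * newmanKernel (-z) s‖ ≤
      2 * Real.exp (1 + 4 * R + R * Real.exp R + (R + 1) ^ 2) * Real.exp (-|s|) := by
  refine (norm_add_le _ _).trans ?_
  have h1 := norm_exp_mul_newmanKernel_le z hz s
  have h2 := norm_exp_mul_newmanKernel_le (R := R) (-z) (by rwa [norm_neg]) s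
  linarith

/-- As `s → -∞` each kernel tends to `1`, so only the difference is integrable. It vanishes at `z =
0`, and the mean value inequality in `z` transfers the bound on its derivative. -/
theorem integrable_newmanKernel_sub (z : ℂ) :
    MeasureTheory.Integrable fun s : ℝ => newmanKernel z s - newmanKernel (-z) s := by
  refine ((integrable_exp_neg_abs.const_mul (2 * Real.exp (1 + 4 * ‖z‖ + ‖z‖ * Real.exp ‖z‖ +
    (‖z‖ + 1) ^ 2))).mul_const ‖z‖).mono' ?_ (Filter.Eventually.of_forall fun s => ?_)
  · have h1 := (continuous_newmanKernel z).comp Complex.continuous_ofReal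
    have h2 := (continuous_newmanKernel (-z)).comp Complex.continuous_ofReal
    exact (h1.sub h2).aestronglyMeasurable
  · have := Convex.norm_image_sub_le_of_norm_hasDerivWithin_le (𝕜 := ℂ)
      (s := Metric.closedBall 0 ‖z‖) (x := 0) (y := z)
      (fun w _ => (hasDerivAt_newmanKernel_sub w s).hasDerivWithinAt)
      (fun w hw => norm_deriv_newmanKernel_sub_le w (by simpa using hw) s)
      (convex_closedBall _ _) (by simp) (by simp)
    simpa using this

theorem differentiable_halfPlaneStep : Differentiable ℂ halfPlaneStep := by
  intro z
  refine (hasDerivAt_integral_of_dominated_loc_of_deriv_le (s := Metric.ball 0 (‖z‖ + 1))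
    (F' := fun z (s : ℝ) => Complex.exp s * newmanKernel z s + Complex.exp s * newmanKernel (-z) s)
    (Metric.isOpen_ball.mem_nhds (by simp))
    (Filter.Eventually.of_forall fun w => (integrable_newmanKernel_sub w).aestronglyMeasurable)
    (integrable_newmanKernel_sub z) ?_
    (Filter.Eventually.of_forall fun s w hw =>
      norm_deriv_newmanKernel_sub_le w (mem_ball_zero_iff.1 hw).le s)
    (integrable_exp_neg_abs.const_mul _)
    (Filter.Eventually.of_forall fun s w _ =>
      hasDerivAt_newmanKernel_sub w s)).2.differentiableAt
  have h1 := (continuous_newmanKernel z).comp Complex.continuous_ofReal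
  have h2 := (continuous_newmanKernel (-z)).comp Complex.continuous_ofReal
  have h3 := Complex.continuous_exp.comp Complex.continuous_ofReal
  exact ((h3.mul h1).add (h3.mul h2)).aestronglyMeasurable

theorem halfPlaneStep_neg (z : ℂ) : halfPlaneStep (-z) = -halfPlaneStep z := by
  rw [halfPlaneStep, halfPlaneStep, ← MeasureTheory.integral_neg]
  simp

-- On the right edge the real part of the exponent is at most `-exp T * (cos θ + sin θ) ≤ -exp T`;
-- the bound on `z.im` ensures `z.im - θ ≥ 1`.
open Complex Filter Real in
theorem tendsto_integral_newmanKernel_right {z : ℂ} (hz : π / 2 + 1 ≤ z.im) :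
    Tendsto (fun T : ℝ => ∫ θ in (0 : ℝ)..π / 2, newmanKernel z (T + θ * I)) atTop (𝓝 0) := by
  have hlim : Tendsto (fun T : ℝ => rexp (-T) * |π / 2 - 0|) atTop (𝓝 0) := by
    simpa using (tendsto_exp_neg_atTop_nhds_zero).mul_const |π / 2 - 0|
  refine squeeze_zero_norm' ?_ hlim
  filter_upwards [eventually_ge_atTop (|z.re| + 1)] with T hT
  refine intervalIntegral.norm_integral_le_of_norm_le_const fun θ hθ => ?_
  rw [Set.uIoc_of_le (by positivity)] at hθ
  have hs : 0 ≤ Real.sin θ := sin_nonneg_of_nonneg_of_le_pi hθ.1.le (by linarith [hθ.2, pi_pos])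
  have hc : 0 ≤ Real.cos θ := cos_nonneg_of_mem_Icc ⟨by linarith [hθ.1, pi_pos], hθ.2⟩
  have hsc : 1 ≤ Real.cos θ + Real.sin θ := by
    nlinarith [Real.sin_sq_add_cos_sq θ]
  rw [newmanKernel, Complex.norm_exp, Real.exp_le_exp]
  have hre : ((z - (T + θ * I)) * cexp (T + θ * I)).re =
      rexp T * ((z.re - T) * Real.cos θ - (z.im - θ) * Real.sin θ) := by
    rw [Complex.mul_re, Complex.exp_re, Complex.exp_im]
    simp
    ring
  rw [hre]
  have h1 : (z.re - T) * Real.cos θ ≤ -Real.cos θ := by nlinarith [le_abs_self z.re]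
  have h2 : Real.sin θ ≤ (z.im - θ) * Real.sin θ := by nlinarith [hθ.2]
  have h3 := Real.add_one_le_exp T
  nlinarith [Real.exp_pos T]

open Complex Filter Real in
theorem tendsto_integral_newmanKernel_left (z : ℂ) :
    Tendsto (fun T : ℝ => ∫ θ in (0 : ℝ)..π / 2, newmanKernel z ((-T : ℝ) + θ * I)) atTop
      (𝓝 (π / 2)) := by
  have hlim : Tendsto (fun T : ℝ => (‖z‖ + T + 2) * rexp (-T)) atTop (𝓝 0) := by
    have h1 := (tendsto_exp_neg_atTop_nhds_zero).const_mul (‖z‖ + 2)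
    have h2 := tendsto_pow_mul_exp_neg_atTop_nhds_zero 1
    have := h1.add h2
    simp only [mul_zero, add_zero, pow_one] at this
    refine this.congr fun T => by ring
  rw [tendsto_iff_norm_sub_tendsto_zero]
  have hlim2 : Tendsto (fun T : ℝ => 2 * ((‖z‖ + T + 2) * rexp (-T)) * |π / 2 - 0|) atTop (𝓝 0) := by
    simpa using (hlim.const_mul 2).mul_const |π / 2 - 0|
  refine squeeze_zero' (Eventually.of_forall fun _ => norm_nonneg _) ?_ hlim2
  filter_upwards [hlim.eventually_le_const zero_lt_one, eventually_ge_atTop 0] with T hT hT0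
  have hcont : Continuous fun θ : ℝ => newmanKernel z ((-T : ℝ) + θ * I) :=
    (continuous_newmanKernel z).comp (by fun_prop)
  have : (∫ θ in (0 : ℝ)..π / 2, newmanKernel z ((-T : ℝ) + θ * I)) - π / 2 =
      ∫ θ in (0 : ℝ)..π / 2, (newmanKernel z ((-T : ℝ) + θ * I) - 1) := by
    rw [intervalIntegral.integral_sub (hcont.intervalIntegrable _ _) (by simp)]
    simp
  rw [this]
  refine intervalIntegral.norm_integral_le_of_norm_le_const fun θ hθ => ?_
  rw [Set.uIoc_of_le (by positivity)] at hθ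
  have hbd : ‖(z - ((-T : ℝ) + θ * I)) * cexp ((-T : ℝ) + θ * I)‖ ≤ (‖z‖ + T + 2) * rexp (-T) := by
    rw [norm_mul, Complex.norm_exp]
    have h1 : (((-T : ℝ) : ℂ) + θ * I).re = -T := by simp
    rw [h1]
    gcongr
    calc ‖z - ((-T : ℝ) + θ * I)‖ ≤ ‖z‖ + (‖((-T : ℝ) : ℂ)‖ + ‖θ * I‖) :=
          (norm_sub_le _ _).trans (by gcongr; exact norm_add_le _ _)
      _ ≤ ‖z‖ + T + 2 := by
          rw [Complex.norm_real, norm_mul, Complex.norm_real, norm_I, Real.norm_eq_abs,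
            Real.norm_eq_abs, abs_neg, abs_of_nonneg hT0, abs_of_pos hθ.1]
          linarith [hθ.2, Real.pi_le_four]
  exact (norm_exp_sub_one_le (hbd.trans hT)).trans (by gcongr)

-- Cauchy's theorem on a rectangle of height `π/2`. The left edge, where the kernel tends to `1`,
-- supplies the whole limit.
open Complex Filter Real in
theorem tendsto_integral_newmanKernel_sub {z : ℂ} (hz : π / 2 + 1 ≤ z.im) :
    Tendsto (fun T : ℝ => (∫ s in (-T)..T, newmanKernel z s) -
      ∫ s in (-T)..T, newmanKernel z (s + (π / 2 : ℝ) * I)) atTop (𝓝 (π / 2 * I)) := by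
  have h := ((tendsto_integral_newmanKernel_left z).const_mul I).sub
    ((tendsto_integral_newmanKernel_right hz).const_mul I)
  rw [mul_zero, sub_zero, mul_comm] at h
  refine h.congr fun T => ?_
  have hd : Differentiable ℂ (newmanKernel z) := by unfold newmanKernel; fun_prop
  have := integral_boundary_rect_eq_zero_of_differentiableOn (newmanKernel z) ((-T : ℝ) : ℂ)
    (T + (π / 2 : ℝ) * I) hd.differentiableOn
  simp only [ofReal_re, add_re, mul_re, I_re, mul_zero, ofReal_im, I_im, mul_one, sub_self,
    add_zero, add_im, mul_im, zero_add, ofReal_zero, zero_mul, smul_eq_mul] at this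
  linear_combination -this

open Complex in
theorem newmanKernel_conj (z s : ℂ) :
    newmanKernel ((starRingEnd ℂ) z) ((starRingEnd ℂ) s) = (starRingEnd ℂ) (newmanKernel z s) := by
  simp only [newmanKernel, ← exp_conj, map_mul, map_sub]

-- On the line `Im s = π/2` one has `exp s = i exp (Re s)`, so the two terms share a factor decaying
-- as `z.im` grows and differ only by conjugate phases. The resulting sine makes the difference
-- integrable at `-∞`.
open Complex Real in
theorem norm_newmanKernel_sub_conj (z : ℂ) (s : ℝ) :
    ‖newmanKernel z (s + (π / 2 : ℝ) * I) -
      (starRingEnd ℂ) (newmanKernel (-(starRingEnd ℂ) z) (s + (π / 2 : ℝ) * I))‖ =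
      2 * rexp (-(z.im - π / 2) * rexp s) * |Real.sin (s * rexp s)| := by
  have he : cexp ((π / 2 : ℝ) * I) = I := by push_cast; exact exp_pi_div_two_mul_I
  have hn : cexp (-((π / 2 : ℝ) * I)) = -I := by rw [Complex.exp_neg, he, inv_I]
  have h1 : newmanKernel z (s + (π / 2 : ℝ) * I) =
      cexp ((z * I + (π / 2 : ℝ)) * rexp s) * cexp (-((s * rexp s : ℝ) * I)) := by
    rw [newmanKernel, Complex.exp_add, he, ← Complex.exp_add]
    congr 1
    push_cast
    linear_combination (-(π / 2) * cexp s) * I_mul_I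
  have h2 : (starRingEnd ℂ) (newmanKernel (-(starRingEnd ℂ) z) (s + (π / 2 : ℝ) * I)) =
      cexp ((z * I + (π / 2 : ℝ)) * rexp s) * cexp ((s * rexp s : ℝ) * I) := by
    rw [← newmanKernel_conj]
    simp only [map_neg, conj_conj, map_add, map_mul, conj_ofReal, conj_I, mul_neg]
    rw [newmanKernel, Complex.exp_add, hn, ← Complex.exp_add]
    congr 1
    push_cast
    linear_combination (-(π / 2) * cexp s) * I_mul_I
  rw [h1, h2, ← mul_sub, norm_mul, Complex.norm_exp]
  have h3 : cexp (-((s * rexp s : ℝ) * I)) - cexp ((s * rexp s : ℝ) * I) =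
      -2 * I * (Real.sin (s * rexp s) : ℝ) := by
    rw [ofReal_sin, Complex.sin, ← neg_mul]
    linear_combination (cexp (-((s * rexp s : ℝ) : ℂ) * I) - cexp (((s * rexp s : ℝ) : ℂ) * I)) * I_mul_I
  rw [h3, norm_mul, norm_mul, norm_neg, norm_I, Complex.norm_real, Real.norm_eq_abs,
    re_mul_ofReal]
  simp
  ring_nf

open Real in
theorem exp_mul_abs_sin_le {Y : ℝ} (hY : 1 ≤ Y) (s : ℝ) :
    2 * rexp (-Y * rexp s) * |Real.sin (s * rexp s)| ≤ 14 * (1 + s ^ 2)⁻¹ := by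
  have hY' : rexp (-Y * rexp s) ≤ rexp (-rexp s) := by
    rw [Real.exp_le_exp]
    nlinarith [Real.exp_pos s]
  have hq := Real.quadratic_le_exp_of_nonneg (abs_nonneg s)
  have hc := Real.pow_div_factorial_le_exp (|s|) (abs_nonneg s) 3
  rw [← div_eq_mul_inv, le_div_iff₀ (by positivity)]
  have hexp : rexp (-|s|) * rexp |s| = 1 := by rw [← Real.exp_add]; simp
  rcases le_total s 0 with hs | hs
  · have h1 : rexp (-Y * rexp s) ≤ 1 := hY'.trans (by
      rw [Real.exp_le_one_iff]; linarith [Real.exp_pos s])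
    have h2 : |Real.sin (s * rexp s)| ≤ |s| * rexp (-|s|) := by
      refine (Real.abs_sin_le_abs).trans ?_
      rw [abs_mul, Real.abs_exp, abs_of_nonpos hs, neg_neg]
    rw [← sq_abs s]
    have h3 : |s| * (1 + |s| ^ 2) ≤ 7 * rexp |s| := by
      norm_num [Nat.factorial] at hc
      nlinarith [sq_nonneg |s|]
    calc _ ≤ 2 * 1 * (|s| * rexp (-|s|)) * (1 + |s| ^ 2) := by gcongr
      _ = 2 * rexp (-|s|) * (|s| * (1 + |s| ^ 2)) := by ring
      _ ≤ 2 * rexp (-|s|) * (7 * rexp |s|) := by gcongr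
      _ = 14 * (rexp (-|s|) * rexp |s|) := by ring
      _ = 14 := by rw [hexp, mul_one]
  · have h1 : rexp (-Y * rexp s) ≤ rexp (-|s|) := hY'.trans (by
      rw [Real.exp_le_exp, abs_of_nonneg hs]; linarith [Real.add_one_le_exp s])
    rw [← sq_abs s]
    calc _ ≤ 2 * rexp (-|s|) * 1 * (2 * rexp |s|) := by
          gcongr
          · exact Real.abs_sin_le_one _
          · nlinarith [abs_nonneg s]
      _ = 4 * (rexp (-|s|) * rexp |s|) := by ring
      _ ≤ 14 := by rw [hexp]; norm_num

open Filter MeasureTheory Real in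
theorem tendsto_integral_exp_mul_abs_sin :
    Tendsto (fun Y : ℝ => ∫ s : ℝ, 2 * rexp (-Y * rexp s) * |Real.sin (s * rexp s)|) atTop (𝓝 0) := by
  have : (0 : ℝ) = ∫ _ : ℝ, (0 : ℝ) := by simp
  rw [this]
  refine tendsto_integral_filter_of_dominated_convergence (fun s => 14 * (1 + s ^ 2)⁻¹)
    (Eventually.of_forall fun Y => by fun_prop) ?_ (integrable_inv_one_add_sq.const_mul 14)
    (Eventually.of_forall fun s => ?_)
  · filter_upwards [eventually_ge_atTop 1] with Y hY
    refine Eventually.of_forall fun s => ?_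
    rw [Real.norm_eq_abs, abs_of_nonneg (by positivity)]
    exact exp_mul_abs_sin_le hY s
  · have h1 : Tendsto (fun Y : ℝ => rexp (-(Y * rexp s))) atTop (𝓝 0) :=
      tendsto_exp_neg_atTop_nhds_zero.comp (tendsto_id.atTop_mul_const (Real.exp_pos s))
    simpa using (h1.const_mul 2).mul_const |Real.sin (s * rexp s)|

open Filter MeasureTheory Real in
theorem integrable_exp_mul_abs_sin {Y : ℝ} (hY : 1 ≤ Y) :
    Integrable fun s : ℝ => 2 * rexp (-Y * rexp s) * |Real.sin (s * rexp s)| :=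
  (integrable_inv_one_add_sq.const_mul 14).mono' (by fun_prop) (Eventually.of_forall fun s => by
    rw [Real.norm_eq_abs, abs_of_nonneg (by positivity)]
    exact exp_mul_abs_sin_le hY s)

open Complex Filter Real MeasureTheory in
theorem norm_halfPlaneStep_sub_le {z : ℂ} (hz : π / 2 + 1 ≤ z.im) :
    ‖halfPlaneStep z - π * I‖ ≤
      ∫ s : ℝ, 2 * rexp (-(z.im - π / 2) * rexp s) * |Real.sin (s * rexp s)| := by
  -- The kernel at `-z` cannot be shifted upwards directly, but on the real line it is the conjugate
  -- of the kernel at `-conj z`, which lies in the same half-plane as `z`. The two edge terms `π/2 *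
  -- I` and its conjugate then differ by `π * I`.
  have hz' : π / 2 + 1 ≤ (-(starRingEnd ℂ) z).im := by simpa using hz
  have h1 := tendsto_integral_newmanKernel_sub hz
  have h2 := (Complex.continuous_conj.tendsto _).comp (tendsto_integral_newmanKernel_sub hz')
  have h3 : Tendsto (fun T : ℝ => ∫ s in (-T)..T, (newmanKernel z s - newmanKernel (-z) s)) atTop
      (𝓝 (halfPlaneStep z)) :=
    intervalIntegral_tendsto_integral (integrable_newmanKernel_sub z) tendsto_neg_atTop_atBot
      tendsto_id
  have h4 := (h3.sub (h1.sub h2)).norm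
  have h5 : (π / 2 * I - (starRingEnd ℂ) (π / 2 * I) : ℂ) = π * I := by
    rw [map_mul, conj_I, map_div₀, conj_ofReal, map_ofNat]
    ring
  rw [h5] at h4
  refine le_of_tendsto h4 ?_
  filter_upwards [eventually_ge_atTop 0] with T hT
  have hT' : -T ≤ T := by linarith
  have c1 (z : ℂ) : Continuous fun s : ℝ => newmanKernel z s :=
    (continuous_newmanKernel z).comp (by fun_prop)
  have c2 (z : ℂ) : Continuous fun s : ℝ => newmanKernel z (s + (π / 2 : ℝ) * I) :=
    (continuous_newmanKernel z).comp (by fun_prop)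
  have c3 (z : ℂ) : Continuous fun s : ℝ =>
      (starRingEnd ℂ) (newmanKernel z (s + (π / 2 : ℝ) * I)) :=
    Complex.continuous_conj.comp (c2 z)
  have hconj : ∀ s : ℝ, newmanKernel (-z) s = (starRingEnd ℂ) (newmanKernel (-(starRingEnd ℂ) z) s) :=
    fun s => by rw [← newmanKernel_conj]; simp
  have heq : (∫ s in (-T)..T, (newmanKernel z s - newmanKernel (-z) s)) -
      (((∫ s in (-T)..T, newmanKernel z s) -
        ∫ s in (-T)..T, newmanKernel z (s + (π / 2 : ℝ) * I)) -
      ((starRingEnd ℂ) ∘ fun T : ℝ => (∫ s in (-T)..T, newmanKernel (-(starRingEnd ℂ) z) s) -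
        ∫ s in (-T)..T, newmanKernel (-(starRingEnd ℂ) z) (s + (π / 2 : ℝ) * I)) T) =
      ∫ s in (-T)..T, (newmanKernel z (s + (π / 2 : ℝ) * I) -
        (starRingEnd ℂ) (newmanKernel (-(starRingEnd ℂ) z) (s + (π / 2 : ℝ) * I))) := by
    rw [intervalIntegral.integral_sub ((c1 _).intervalIntegrable _ _)
        ((c1 _).intervalIntegrable _ _),
      intervalIntegral.integral_sub ((c2 _).intervalIntegrable _ _)
        ((c3 _).intervalIntegrable _ _), Function.comp_apply, map_sub]
    simp_rw [hconj]
    rw [intervalIntegral.intervalIntegral_conj, intervalIntegral.intervalIntegral_conj]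
    ring
  rw [heq]
  refine (intervalIntegral.norm_integral_le_integral_norm hT').trans ?_
  simp_rw [norm_newmanKernel_sub_conj]
  rw [intervalIntegral.integral_of_le hT']
  exact setIntegral_le_integral (integrable_exp_mul_abs_sin (by linarith))
    (Eventually.of_forall fun s => by positivity)

open Complex Filter Real in
theorem exists_norm_halfPlaneStep_sub_le {ε : ℝ} (hε : 0 < ε) :
    ∃ Y : ℝ, 0 < Y ∧ ∀ z : ℂ, Y ≤ z.im → ‖halfPlaneStep z - π * I‖ ≤ ε := by
  obtain ⟨Y, hY⟩ := eventually_atTop.1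
    (tendsto_integral_exp_mul_abs_sin.eventually_le_const hε)
  refine ⟨max (Y + π / 2) (π / 2 + 1), by positivity, fun z hz => ?_⟩
  exact (norm_halfPlaneStep_sub_le ((le_max_right _ _).trans hz)).trans
    (hY _ (by linarith [(le_max_left _ _).trans hz]))

open Complex Real in
/-- An entire function uniformly close to `0` in the upper half-plane and to `i / 2` below the line
`Im z = -1`. -/
theorem exists_entire_near_zero_near_half {η : ℝ} (hη : 0 < η) :
    ∃ f : ℂ → ℂ, Differentiable ℂ f ∧ (∀ z : ℂ, -(1 / 4) ≤ z.im → ‖f z‖ ≤ η) ∧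
      ∀ z : ℂ, z.im ≤ -(3 / 4) → ‖f z - I / 2‖ ≤ η := by
  obtain ⟨Y, hY, h⟩ := exists_norm_halfPlaneStep_sub_le hη
  have key : ∀ w : ℂ, ‖w‖ ≤ η → ‖(1 / (4 * π) : ℂ) * w‖ ≤ η := fun w hw => by
    rw [norm_mul, norm_div, norm_mul, norm_one, Complex.norm_ofNat, Complex.norm_real,
      Real.norm_eq_abs, abs_of_pos pi_pos]
    have : 1 / (4 * π) ≤ 1 := by
      rw [div_le_one (by positivity)]; linarith [pi_gt_three]
    calc _ ≤ 1 * ‖w‖ := by gcongr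
      _ ≤ η := by linarith
  have hpi : (π : ℂ) ≠ 0 := ofReal_ne_zero.2 pi_ne_zero
  refine ⟨fun z => I / 4 - 1 / (4 * π) * halfPlaneStep ((4 * Y : ℝ) * (z + I / 2)), ?_,
    fun z hz => ?_, fun z hz => ?_⟩
  · have := differentiable_halfPlaneStep
    fun_prop
  · have := key _ (h ((4 * Y : ℝ) * (z + I / 2)) (by
      rw [im_ofReal_mul]; simp; nlinarith))
    rw [← norm_neg] at this
    refine (le_of_eq (congrArg norm ?_)).trans this
    field_simp
    ring
  · have := key _ (h (-((4 * Y : ℝ) * (z + I / 2))) (by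
      rw [neg_im, im_ofReal_mul]; simp; nlinarith))
    rw [halfPlaneStep_neg] at this
    refine (le_of_eq (congrArg norm ?_)).trans this
    field_simp
    ring

/-! ### A growth function and the two shears -/

/-- An explicit entire function of rapid growth, positive near the lines `Im w ∈ ℤ` and negative
near the lines `Im w ∈ ℤ + 1/2`. -/
noncomputable def coshGrowth (w : ℂ) : ℂ :=
  Complex.cosh (2 * Real.pi * w) * (20 + 2 * Complex.cosh (2 * Real.pi * w) ^ 2 - w ^ 2)

theorem differentiable_coshGrowth : Differentiable ℂ coshGrowth := by
  unfold coshGrowth; fun_prop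

/-- Here `c` stands for `± cosh (2πw)`. Its cube controls growth in `w.re`; since `cosh` is periodic
in the imaginary direction, growth in `w.im` must come from `-w ^ 2`. -/
theorem norm_add_le_re_mul {c w : ℂ} (h1 : 9 / 10 ≤ c.re) (hy : |w.re| ≤ c.re)
    (hb : |c.im| ≤ c.re / 10) : ‖w‖ + 13 ≤ (c * (20 + 2 * c ^ 2 - w ^ 2)).re := by
  have hre : (c * (20 + 2 * c ^ 2 - w ^ 2)).re =
      c.re * (20 + 2 * (c.re ^ 2 - c.im ^ 2) - w.re ^ 2 + w.im ^ 2) -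
        4 * c.re * c.im ^ 2 + 2 * c.im * (w.re * w.im) := by
    simp [pow_two]
    ring
  have hw : ‖w‖ ≤ |w.re| + |w.im| := Complex.norm_le_abs_re_add_abs_im w
  rw [hre]
  generalize c.re = a at *
  generalize c.im = b at *
  generalize w.re = y at *
  generalize w.im = v at *
  have hy2 : y ^ 2 ≤ a ^ 2 := sq_le_sq' (by linarith [(abs_le.1 hy).1]) (abs_le.1 hy).2
  have hb2 : b ^ 2 ≤ (a / 10) ^ 2 := sq_le_sq' (abs_le.1 hb).1 (abs_le.1 hb).2
  have hcross : -(a / 10 * (y ^ 2 + v ^ 2)) ≤ 2 * b * (y * v) := by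
    have h3 : |2 * b * (y * v)| ≤ a / 10 * (y ^ 2 + v ^ 2) := by
      rw [show 2 * b * (y * v) = b * (2 * y * v) by ring, abs_mul]
      refine mul_le_mul hb ?_ (abs_nonneg _) (by linarith)
      rw [abs_le]
      constructor <;> nlinarith [sq_nonneg (y + v), sq_nonneg (y - v)]
    exact (abs_le.1 h3).1
  have hmain : 9 / 10 * (20 + 4 / 5 * y ^ 2 + 9 / 10 * v ^ 2) ≤
      a * (20 + 2 * (a ^ 2 - b ^ 2) - y ^ 2 + v ^ 2) - 4 * a * b ^ 2 + 2 * b * (y * v) := by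
    have h4 : 0 ≤ 20 + 4 / 5 * y ^ 2 + 9 / 10 * v ^ 2 := by positivity
    have h5 : 9 / 10 * (20 + 4 / 5 * y ^ 2 + 9 / 10 * v ^ 2) ≤
        a * (20 + 4 / 5 * y ^ 2 + 9 / 10 * v ^ 2) := by gcongr
    have h6 : 0 ≤ a * (a ^ 2 - y ^ 2) := mul_nonneg (by linarith) (by linarith)
    have h7 : 0 ≤ a * ((a / 10) ^ 2 - b ^ 2) := mul_nonneg (by linarith) (by linarith)
    nlinarith [pow_pos (show 0 < a by linarith) 3]
  nlinarith [sq_nonneg (|y| - 3 / 4), sq_nonneg (|v| - 3 / 4), sq_abs y, sq_abs v]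

open Real in
theorem cosh_bounds {w : ℂ} (n : ℤ) (h : |w.im - n| ≤ 1 / 100) :
    9 / 10 ≤ (Complex.cosh (2 * π * w)).re ∧ |w.re| ≤ (Complex.cosh (2 * π * w)).re ∧
      |(Complex.cosh (2 * π * w)).im| ≤ (Complex.cosh (2 * π * w)).re / 10 := by
  set s := w.im - n with hs
  set y := w.re with hy
  have hw : (2 * π * w : ℂ) = ((2 * π * y : ℝ) : ℂ) + ((2 * π * s : ℝ) : ℂ) * Complex.I +
      n * (2 * π * Complex.I) := by
    conv_lhs => rw [← Complex.re_add_im w]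
    rw [hs, hy]
    push_cast
    ring
  have hc : Complex.cosh (2 * π * w) =
      Complex.cosh (((2 * π * y : ℝ) : ℂ) + ((2 * π * s : ℝ) : ℂ) * Complex.I) := by
    rw [Complex.cosh, Complex.cosh, hw, neg_add, ← neg_mul, ← Int.cast_neg,
      Complex.exp_add _ (n * (2 * π * Complex.I)), Complex.exp_add _ ((-n : ℤ) * _),
      Complex.exp_int_mul_two_pi_mul_I, Complex.exp_int_mul_two_pi_mul_I, mul_one, mul_one]
  rw [hc, Complex.cosh_add, Complex.cosh_mul_I, Complex.sinh_mul_I, ← Complex.ofReal_cosh,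
    ← Complex.ofReal_sinh, ← Complex.ofReal_cos, ← Complex.ofReal_sin]
  simp only [Complex.add_re, Complex.add_im, Complex.mul_re, Complex.mul_im, Complex.ofReal_re,
    Complex.ofReal_im, Complex.I_re, Complex.I_im, mul_zero, sub_zero, zero_mul, mul_one, add_zero,
    sub_self, zero_add]
  have hpi := pi_gt_three
  have hpi' := pi_lt_d2
  have hs' : |2 * π * s| ≤ 63 / 1000 := by
    rw [abs_mul, abs_of_pos (by positivity : 0 < 2 * π)]
    nlinarith [abs_nonneg s]
  have hcos : 99 / 100 ≤ Real.cos (2 * π * s) := by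
    have := one_sub_sq_div_two_le_cos (x := 2 * π * s)
    rw [← sq_abs] at this
    nlinarith [abs_nonneg (2 * π * s)]
  have hsin : |Real.sin (2 * π * s)| ≤ 63 / 1000 := (Real.abs_sin_le_abs).trans hs'
  have hcosh1 := Real.one_le_cosh (2 * π * y)
  have hcosh : 3 * |y| ≤ Real.cosh (2 * π * y) := by
    rw [← Real.cosh_abs, Real.cosh_eq, abs_mul, abs_of_pos (by positivity : 0 < 2 * π)]
    have := Real.add_one_le_exp (2 * π * |y|)
    have := Real.exp_pos (-(2 * π * |y|))
    nlinarith [abs_nonneg y]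
  have hsinh : |Real.sinh (2 * π * y)| ≤ Real.cosh (2 * π * y) := by
    rw [abs_le]
    constructor <;> rw [Real.cosh_eq, Real.sinh_eq] <;>
      linarith [Real.exp_pos (2 * π * y), Real.exp_pos (-(2 * π * y))]
  refine ⟨by nlinarith, by nlinarith [abs_nonneg y], ?_⟩
  rw [abs_mul]
  have : |Real.sinh (2 * π * y)| * |Real.sin (2 * π * s)| ≤ Real.cosh (2 * π * y) * (63 / 1000) := by
    gcongr
  nlinarith

theorem norm_add_le_re_coshGrowth {w : ℂ} (n : ℤ) (h : |w.im - n| ≤ 1 / 100) :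
    ‖w‖ + 13 ≤ (coshGrowth w).re := by
  obtain ⟨h1, h2, h3⟩ := cosh_bounds n h
  exact norm_add_le_re_mul h1 h2 h3

theorem re_coshGrowth_le {w : ℂ} (n : ℤ) (h : |w.im - (n + 1 / 2)| ≤ 1 / 100) :
    (coshGrowth w).re ≤ -(‖w‖ + 13) := by
  have hshift : Complex.cosh (2 * Real.pi * (w - Complex.I / 2)) =
      -Complex.cosh (2 * Real.pi * w) := by
    rw [mul_sub, show 2 * (Real.pi : ℂ) * (Complex.I / 2) = Real.pi * Complex.I by ring,
      Complex.cosh_sub, Complex.cosh_mul_I, Complex.sinh_mul_I, Complex.cos_pi, Complex.sin_pi]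
    simp
  obtain ⟨h1, h2, h3⟩ := cosh_bounds (w := w - Complex.I / 2) n (by
    convert h using 2
    simp
    ring)
  rw [hshift] at h1 h2 h3
  have h2' : |w.re| ≤ (-Complex.cosh (2 * Real.pi * w)).re := by simpa using h2
  have := norm_add_le_re_mul h1 h2' h3
  rw [neg_sq, neg_mul, Complex.neg_re] at this
  rw [coshGrowth]
  linarith

/-- A composition of two shears that moves the product of neighbourhoods of the lines `Im ∈ ℤ` into
the set avoided by the Fatou–Bieberbach map of `exists_injective_entire_avoiding`. -/
theorem exists_shears :
    ∃ M N : ℂ × ℂ → ℂ × ℂ, Differentiable ℂ M ∧ Differentiable ℂ N ∧ (∀ x, M (N x) = x) ∧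
      ∀ x : ℂ × ℂ, (∃ n : ℤ, |x.1.im - n| ≤ 1 / 200) → (∃ n : ℤ, |x.2.im - n| ≤ 1 / 200) →
        12 ≤ ‖(M x).1‖ ∧ ‖(M x).2‖ ≤ ‖(M x).1‖ := by
  obtain ⟨f, hf, hup, hdown⟩ := exists_entire_near_zero_near_half (η := 1 / 200) (by norm_num)
  have hG := differentiable_coshGrowth
  refine ⟨fun x => (x.1 + Complex.I * coshGrowth (x.2 + f x.1), x.2 + f x.1),
    fun x => (x.1 - Complex.I * coshGrowth x.2, x.2 - f (x.1 - Complex.I * coshGrowth x.2)),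
    by fun_prop, by fun_prop, fun x => by simp, ?_⟩
  rintro ⟨z, w⟩ ⟨k, hk⟩ ⟨l, hl⟩
  simp only at hk hl ⊢
  set w' := w + f z with hw'
  have him : (z + Complex.I * coshGrowth w').im = z.im + (coshGrowth w').re := by simp
  have hle := (abs_le.1 (Complex.abs_im_le_norm (z + Complex.I * coshGrowth w')))
  rw [him] at hle
  rw [abs_le] at hk hl
  have hn := norm_nonneg w'
  -- In both cases `Re G` gets the sign of `k`, so it reinforces `z.im` up to `1/200`. The tolerance
  -- `1/100` for `w'` is `1/200` from `w` plus `1/200` from the error of `f`.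
  rcases le_or_gt 0 k with hk0 | hk0
  · have hk' : (0 : ℝ) ≤ k := by exact_mod_cast hk0
    have h1 := hup z (by linarith)
    have h2 := abs_le.1 ((Complex.abs_im_le_norm _).trans h1)
    have := norm_add_le_re_coshGrowth (w := w') l (by
      rw [hw', Complex.add_im, abs_le]
      constructor <;> linarith)
    constructor <;> linarith
  · have hk' : (k : ℝ) ≤ -1 := by exact_mod_cast (by omega : k ≤ -1)
    have h1 := hdown z (by linarith)
    have h2 := abs_le.1 ((Complex.abs_im_le_norm _).trans h1)
    have h3 : (f z - Complex.I / 2).im = (f z).im - 1 / 2 := by simp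
    rw [h3] at h2
    have := re_coshGrowth_le (w := w') l (by
      rw [hw', Complex.add_im, abs_le]
      constructor <;> linarith)
    constructor <;> linarith

/-! ### Diophantine approximation and coordinates adapted to the lattice -/

/-- Simultaneous Diophantine approximation. -/
theorem exists_nat_mul_near_int {ι : Type*} [Finite ι] (a : ι → ℝ) {η : ℝ} (hη : 0 < η) :
    ∃ q : ℕ, 0 < q ∧ ∀ i, ∃ n : ℤ, |q * a i - n| ≤ η := by
  obtain ⟨N, hN⟩ := exists_nat_gt (1 / η)
  have hN0 : (0 : ℝ) < N := (one_div_pos.2 hη).trans hN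
  have hlt : ∀ x : ℝ, ⌊N * Int.fract x⌋₊ < N := fun x => by
    rw [Nat.floor_lt (mul_nonneg hN0.le (Int.fract_nonneg x))]
    nlinarith [Int.fract_lt_one x]
  have key : ∀ k l : ℕ, k < l → (∀ i, ⌊N * Int.fract (k * a i)⌋₊ = ⌊N * Int.fract (l * a i)⌋₊) →
      ∃ q : ℕ, 0 < q ∧ ∀ i, ∃ n : ℤ, |q * a i - n| ≤ η := fun k l hkl h => by
    refine ⟨l - k, by omega, fun i => ⟨⌊l * a i⌋ - ⌊k * a i⌋, ?_⟩⟩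
    have h1 := Nat.floor_le (mul_nonneg hN0.le (Int.fract_nonneg (k * a i)))
    have h2 := Nat.lt_floor_add_one (N * Int.fract (k * a i))
    have h3 := Nat.floor_le (mul_nonneg hN0.le (Int.fract_nonneg (l * a i)))
    have h4 := Nat.lt_floor_add_one (N * Int.fract (l * a i))
    rw [h i] at h1 h2
    have h5 : ((l - k : ℕ) : ℝ) * a i - (⌊l * a i⌋ - ⌊k * a i⌋ : ℤ) =
        Int.fract (l * a i) - Int.fract (k * a i) := by
      rw [Int.fract, Int.fract]
      push_cast [hkl.le]
      ring
    have h6 : 1 < N * η := by rwa [div_lt_iff₀ hη] at hN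
    rw [h5, abs_le]
    constructor
    · by_contra! hc
      nlinarith
    · by_contra! hc
      nlinarith
  -- Pigeonhole: two multiples have their fractional parts in the same box of side `1 / N`.
  obtain ⟨k, l, hkl, h⟩ := Finite.exists_ne_map_eq_of_infinite
    fun (k : ℕ) (i : ι) => (⟨⌊N * Int.fract (k * a i)⌋₊, hlt _⟩ : Fin N)
  have h' : ∀ i, ⌊N * Int.fract (k * a i)⌋₊ = ⌊N * Int.fract (l * a i)⌋₊ := fun i => by
    simpa using congrFun h i
  rcases lt_or_gt_of_ne hkl with hlt | hlt
  · exact key k l hlt h'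
  · exact key l k hlt fun i => (h' i).symm

/-- A discrete subgroup of a real vector space is generated by part of a basis. -/
theorem exists_basis_le_span_int {E : Type*} [NormedAddCommGroup E] [NormedSpace ℝ E]
    [FiniteDimensional ℝ E] (Λ : Submodule ℤ E) [DiscreteTopology Λ] :
    ∃ (s : Set E) (b : Module.Basis s ℝ E), Λ ≤ Submodule.span ℤ (Set.range b) := by
  let f := (Submodule.span ℝ (Λ : Set E)).subtype
  let L₀ := Λ.comap (f.restrictScalars ℤ)
  have h_map : L₀.map (f.restrictScalars ℤ) = Λ := by
    rw [Submodule.map_comap_eq_self]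
    exact fun x hx => LinearMap.mem_range.mpr ⟨⟨x, Submodule.subset_span hx⟩, rfl⟩
  have h_img : f '' L₀ = Λ := by
    conv_rhs => rw [← h_map]
    rfl
  have : DiscreteTopology L₀ := by
    refine DiscreteTopology.preimage_of_continuous_injective (Λ : Set E) ?_
      (Submodule.injective_subtype _)
    exact LinearMap.continuous_of_finiteDimensional f
  have : IsZLattice ℝ L₀ := ⟨by
    rw [← (Submodule.map_injective_of_injective (Submodule.injective_subtype _)).eq_iff,
      Submodule.map_span, Submodule.map_top, Submodule.range_subtype, h_img]⟩
  let c := (Module.Free.chooseBasis ℤ L₀).ofZLatticeBasis ℝ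
  have hc : Submodule.span ℤ (Set.range c) = L₀ :=
    (Module.Free.chooseBasis ℤ L₀).ofZLatticeBasis_span ℝ
  have hli : LinearIndependent ℝ (f ∘ c) :=
    c.linearIndependent.map' f (Submodule.ker_subtype _)
  have hli' := hli.linearIndepOn_id
  refine ⟨_, Module.Basis.extend hli', ?_⟩
  rw [Module.Basis.range_extend]
  refine h_map.symm.le.trans ((Submodule.map_mono hc.ge).trans ?_)
  rw [Submodule.map_span]
  refine Submodule.span_mono ?_
  refine subset_trans ?_ (hli'.subset_extend _)
  rintro _ ⟨_, ⟨i, rfl⟩, rfl⟩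
  exact ⟨i, rfl⟩

/-- Complex linear coordinates on `ℂ²` whose imaginary parts are integral on a discrete subgroup. -/
theorem exists_equiv_im_int (Λ : Submodule ℤ (ℂ × ℂ)) [DiscreteTopology Λ] :
    ∃ T : (ℂ × ℂ) ≃L[ℂ] ℂ × ℂ,
      ∀ v ∈ Λ, (∃ n : ℤ, (T v).1.im = n) ∧ ∃ n : ℤ, (T v).2.im = n := by
  obtain ⟨s, b, hb⟩ := exists_basis_le_span_int Λ
  have hint : ∀ i, ∀ v ∈ Λ, ∃ n : ℤ, b.coord i v = n := fun i v hv => by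
    have := (b.mem_span_iff_repr_mem ℤ v).1 (hb hv) i
    obtain ⟨n, hn⟩ := this
    exact ⟨n, by simpa using hn.symm⟩
  -- Every real linear functional is the imaginary part of a unique complex linear one; `ζ i` is the
  -- one belonging to the real coordinate `b.coord i`.
  let ζ : s → (ℂ × ℂ) →ₗ[ℂ] ℂ := fun i =>
    { toFun := fun v => b.coord i (Complex.I • v) + Complex.I * b.coord i v
      map_add' := fun u v => by
        rw [smul_add, map_add, map_add]
        push_cast
        ring
      map_smul' := fun c v => by
        have h1 : c • v = c.re • v + c.im • (Complex.I • v) := by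
          conv_lhs => rw [← Complex.re_add_im c, add_smul, mul_smul]
          simp [Complex.coe_smul]
        have h2 : Complex.I • c • v = c.re • (Complex.I • v) - c.im • v := by
          rw [h1, smul_add, smul_comm Complex.I c.re, smul_comm Complex.I c.im, smul_smul,
            Complex.I_mul_I, neg_one_smul, smul_neg, sub_eq_add_neg]
        rw [h2, h1, map_sub, map_add, LinearMap.map_smul, LinearMap.map_smul,
          LinearMap.map_smul, LinearMap.map_smul]
        conv_rhs => rw [RingHom.id_apply, smul_eq_mul, ← Complex.re_add_im c]
        simp only [smul_eq_mul]
        push_cast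
        linear_combination (-(c.im : ℂ) * (b.coord i v : ℂ)) * Complex.I_mul_I }
  have hζ : ∀ i v, (ζ i v).im = b.coord i v := fun i v => by simp [ζ]
  have hne : ∀ v : ℂ × ℂ, v ≠ 0 → ∃ i, ζ i v ≠ 0 := fun v hv => by
    by_contra! h
    refine hv (b.ext_elem fun i => ?_)
    have := hζ i v
    rw [h i] at this
    simpa using this.symm
  obtain ⟨i, hi⟩ := hne (1, 0) (by simp)
  obtain ⟨v, hv, hv0⟩ : ∃ v, ζ i v = 0 ∧ v ≠ 0 := by
    have := LinearMap.ker_ne_bot_of_finrank_lt (f := ζ i) (by simp)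
    obtain ⟨v, hv, h0⟩ := (Submodule.ne_bot_iff _).1 this
    exact ⟨v, hv, h0⟩
  -- A form nonzero on a kernel vector of `ζ i` is independent of `ζ i`.
  obtain ⟨j, hj⟩ := hne v hv0
  have hsurj : Function.Surjective ((ζ i).prod (ζ j)) := by
    rintro ⟨x, y⟩
    refine ⟨(x / ζ i (1, 0)) • ((1, 0) : ℂ × ℂ) +
      ((y - x / ζ i (1, 0) * ζ j (1, 0)) / ζ j v) • v, ?_⟩
    change (ζ i _, ζ j _) = _
    rw [map_add, map_smul, map_smul, map_add, map_smul, map_smul, hv]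
    simp only [smul_eq_mul, mul_zero, add_zero, Prod.mk.injEq]
    constructor <;> field_simp
    ring
  refine ⟨(LinearEquiv.ofBijective ((ζ i).prod (ζ j))
    ⟨LinearMap.injective_iff_surjective.2 hsurj, hsurj⟩).toContinuousLinearEquiv, fun v hv => ?_⟩
  exact ⟨(hint i v hv).imp fun n hn => (hζ i v).trans hn,
    (hint j v hv).imp fun n hn => (hζ j v).trans hn⟩

/-! ### Avoiding the bidisks, and descent to the torus -/

theorem exists_injective_entire_avoiding_bidiskUnion (Λ : Submodule ℤ (ℂ × ℂ))
    [DiscreteTopology Λ] {m : ℕ} (p : Fin m → ℂ × ℂ) :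
    ∃ r : ℝ, 0 < r ∧ ∃ F : ℂ × ℂ → ℂ × ℂ, Differentiable ℂ F ∧ Function.Injective F ∧
      (∀ z, F z ∈ (bidiskUnion Λ p r)ᶜ) ∧ (fderiv ℂ F 0).det ≠ 0 := by
  obtain ⟨T, hT⟩ := exists_equiv_im_int Λ
  obtain ⟨q, hq, hqp⟩ := exists_nat_mul_near_int
    (fun i : Fin m ⊕ Fin m => Sum.elim (fun j => (T (p j)).1.im) (fun j => (T (p j)).2.im) i)
    (η := 1 / 400) (by norm_num)
  obtain ⟨M, N, hM, hN, hMN, hMV⟩ := exists_shears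
  obtain ⟨F, hF, hFinj, hF0, hFV⟩ := exists_injective_entire_avoiding
  have hqC : (q : ℂ) ≠ 0 := Nat.cast_ne_zero.2 hq.ne'
  set K : ℝ := ‖(T : (ℂ × ℂ) →L[ℂ] ℂ × ℂ)‖ with hK
  have hK0 : 0 ≤ K := norm_nonneg _
  have hq0 : (0 : ℝ) < q := Nat.cast_pos.2 hq
  have hTi : Differentiable ℂ fun x => T.symm ((q : ℂ)⁻¹ • x) := by fun_prop
  have hTd : Differentiable ℂ fun x => (q : ℂ) • T x := by fun_prop
  have hsub : ∀ x, (q : ℂ) • T (T.symm ((q : ℂ)⁻¹ • x)) = x := fun x => by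
    rw [T.apply_symm_apply, smul_inv_smul₀ hqC]
  have hcomp : ∀ z, M ((q : ℂ) • T (T.symm ((q : ℂ)⁻¹ • N (F z)))) = F z := fun z => by
    rw [hsub, hMN]
  have hFd : Differentiable ℂ fun z => T.symm ((q : ℂ)⁻¹ • N (F z)) := hTi.comp (hN.comp hF)
  -- With this radius `q * T` moves points of a bidisk by at most `1/400` from the image of its
  -- centre; the Diophantine error adds `1/400`, giving the width `1/200` of the strips in
  -- `exists_shears`.
  refine ⟨1 / (400 * q * (K + 1)), by positivity, fun z => T.symm ((q : ℂ)⁻¹ • N (F z)), hFd,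
    fun z w h => ?_, fun z hz => ?_, fun hdet => ?_⟩
  · apply hFinj
    rw [← hcomp z, ← hcomp w]
    exact congrArg (fun x => M ((q : ℂ) • T x)) h
  · simp only [bidiskUnion, translates, Set.mem_iUnion] at hz
    obtain ⟨_, ⟨j, v, hv, rfl⟩, hz⟩ := hz
    refine hFV z ?_
    rw [← hcomp z]
    set x := T.symm ((q : ℂ)⁻¹ • N (F z))
    set d := x - (v + p j) with hd
    have hdn : ‖d‖ ≤ 1 / (400 * q * (K + 1)) := by
      rw [Prod.norm_def]
      exact max_le hz.1.le hz.2.le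
    have hTdn : q * ‖T d‖ ≤ 1 / 400 := by
      have h1 : ‖T d‖ ≤ K * ‖d‖ := (T : (ℂ × ℂ) →L[ℂ] ℂ × ℂ).le_opNorm d
      have h2 : K * ‖d‖ ≤ (K + 1) * (1 / (400 * q * (K + 1))) := by gcongr; linarith
      calc q * ‖T d‖ ≤ q * ((K + 1) * (1 / (400 * q * (K + 1)))) := by gcongr; exact h1.trans h2
        _ = 1 / 400 := by field_simp
    have hx : T x = T d + (T v + T (p j)) := by rw [← map_add, ← map_add, hd, sub_add_cancel]
    have key : ∀ a b c : ℝ, |a| ≤ ‖T d‖ → (∃ n : ℤ, b = n) → (∃ n : ℤ, |q * c - n| ≤ 1 / 400) →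
        ∃ n : ℤ, |q * (a + (b + c)) - n| ≤ 1 / 200 := by
      rintro a _ c ha ⟨n, rfl⟩ ⟨k, hk⟩
      refine ⟨q * n + k, ?_⟩
      have h1 : |q * a| ≤ 1 / 400 := by
        rw [abs_mul, abs_of_pos hq0]
        exact (mul_le_mul_of_nonneg_left ha hq0.le).trans hTdn
      push_cast
      rw [abs_le] at h1 hk ⊢
      constructor <;> linarith
    refine hMV _ ?_ ?_
    · obtain ⟨n, hn⟩ := key _ _ _ ((Complex.abs_im_le_norm _).trans (norm_fst_le (T d)))
        (hT v hv).1 (hqp (Sum.inl j))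
      refine ⟨n, ?_⟩
      rw [hx]
      convert hn using 3
      simp
      ring
    · obtain ⟨n, hn⟩ := key _ _ _ ((Complex.abs_im_le_norm _).trans (norm_snd_le (T d)))
        (hT v hv).2 (hqp (Sum.inr j))
      refine ⟨n, ?_⟩
      rw [hx]
      convert hn using 3
      simp
      ring
  -- Composed with `M ∘ (q • T)` the map becomes `F`, whose derivative at `0` is the identity, so
  -- its own derivative there is invertible.
  · have hfun : (fun x => M ((q : ℂ) • T x)) ∘ (fun z => T.symm ((q : ℂ)⁻¹ • N (F z))) = F :=
      funext hcomp
    have hchain := fderiv_comp (𝕜 := ℂ) 0 ((hM.comp hTd) (T.symm ((q : ℂ)⁻¹ • N (F 0)))) (hFd 0)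
    have hfun' : ((M ∘ fun x => (q : ℂ) • T x) ∘ fun z => T.symm ((q : ℂ)⁻¹ • N (F z))) = F := hfun
    rw [hfun', hF0] at hchain
    have := congrArg ContinuousLinearMap.det hchain
    simp only [ContinuousLinearMap.det] at this hdet
    rw [ContinuousLinearMap.toLinearMap_comp, LinearMap.det_comp, hdet, mul_zero] at this
    simp at this

theorem theorem6p1 (Λ : Submodule ℤ (ℂ × ℂ)) [DiscreteTopology Λ] :
    (∀ (m : ℕ) (p : Fin m → ℂ × ℂ), ∃ r : ℝ, 0 < r ∧
      ∃ F : ℂ × ℂ → ℂ × ℂ, Differentiable ℂ F ∧ Function.Injective F ∧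
        ∀ z, F z ∈ (bidiskUnion Λ p r)ᶜ) ∧
    (IsZLattice ℝ Λ → ∀ E : Set ((ℂ × ℂ) ⧸ Λ), E.Finite →
      ∃ U : Set ((ℂ × ℂ) ⧸ Λ), IsOpen U ∧ E ⊆ U ∧
        ∃ F : ℂ × ℂ → (ℂ × ℂ) ⧸ Λ, IsDominatingToTorus Λ F ∧ ∀ z, F z ∈ Uᶜ) := by
  refine ⟨fun m p => ?_, fun _ E hE => ?_⟩
  · obtain ⟨r, hr, F, hF, hinj, hav, -⟩ := exists_injective_entire_avoiding_bidiskUnion Λ p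
    exact ⟨r, hr, F, hF, hinj, hav⟩
  · obtain ⟨m, e, -, rfl⟩ := hE.fin_param
    choose p hp using fun j => Λ.mkQ_surjective (e j)
    obtain ⟨r, hr, F, hF, -, hav, hdet⟩ := exists_injective_entire_avoiding_bidiskUnion Λ p
    have hlift : ∀ z, IsHolomorphicLiftAt Λ (fun z => Λ.mkQ (F z)) F z := fun z =>
      Filter.Eventually.of_forall fun w => ⟨hF w, rfl⟩
    refine ⟨Λ.mkQ '' ⋃ j, bidisk (p j) r, ?_, ?_, fun z => Λ.mkQ (F z),
      ⟨fun z => ⟨F, hlift z⟩, 0, F, hlift 0, hdet⟩, ?_⟩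
    · refine Λ.isOpenMap_mkQ _ (isOpen_iUnion fun j => ?_)
      have h1 : Continuous fun z : ℂ × ℂ => ‖z.1 - (p j).1‖ := by fun_prop
      have h2 : Continuous fun z : ℂ × ℂ => ‖z.2 - (p j).2‖ := by fun_prop
      exact (isOpen_lt h1 continuous_const).inter (isOpen_lt h2 continuous_const)
    · rintro _ ⟨j, rfl⟩
      exact ⟨p j, Set.mem_iUnion.2 ⟨j, by simpa [bidisk] using hr⟩, hp j⟩
    · rintro z ⟨u, hu, huz⟩
      obtain ⟨j, hj⟩ := Set.mem_iUnion.1 hu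
      -- The bidisks about the `p j` represent all their translates modulo `Λ`, so meeting `U` in
      -- the torus means meeting some translated bidisk in `ℂ²`.
      have hmem : F z - u ∈ Λ := (Submodule.Quotient.eq Λ).1 huz.symm
      refine hav z ?_
      simp only [bidiskUnion, translates, Set.mem_iUnion]
      refine ⟨F z - u + p j, ⟨j, F z - u, hmem, rfl⟩, ?_⟩
      have h : F z - (F z - u + p j) = u - p j := by abel
      constructor
      · rw [← Prod.fst_sub, h]
        exact hj.1
      · rw [← Prod.snd_sub, h]
        exact hj.2
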